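/- For a C*-algebra $A$ regard $A^{**}$ as the enveloping von Neumann algebra of $A$, and let $\bar\otimes$ be the von Neumann algebra tensor product. A \emph{unital C*-Eberlein algebra} $(A,\Phi,V,H)$ consists of a unital C*-algebra $A$, a Hilbert space $H$, a unital $*$-homomorphism $\Phi:A\to A^{**}\bar\otimes A^{**}$ and a contraction $V\in A^{**}\bar\otimes\mathcal B(H)$ such that: (i) the set $A_V=\{(\mathrm{id}\otimes\omega)(V):\omega\in\mathcal B(H)_*\}$ is contained in $A\subseteq A^{**}$ and is norm dense in $A$; (ii) the product $\star$ on $A^*$ given by $\langle\mu\star\nu,a\rangle=\langle\Phi(a),\mu\otimes\nu\rangle$ is associative; (iii) $\mu\mapsto(\mu\otimes\mathrm{id})(V)$ is a homomorphism $(A^*,\star)\to\mathcal B(H)$. A state $M$ on $A$ is a \emph{left} (respectively \emph{right}) \emph{invariant mean} if $\mu\star M=M$ (respectively $M\star\mu=M$) for every state $\mu$ on $A$, and an \emph{invariant mean} if it is both. A vector $\xi\in H$ is \emph{invariant} for $V$ if $(\mu\otimes\mathrm{id})(V)\xi=\mu(1)\xi$ for all $\mu\in A^*$; the closed subspace of these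 vectors is denoted $\mathrm{Inv}(V)$. Theorem. Let $(A,\Phi,V,H)$ be a unital C*-Eberlein algebra and let $M\in A^*$ be a left invariant mean. Then $M$ is the unique left invariant mean, and $(M\otimes\mathrm{id})(V)\in\mathcal B(H)$ is the orthogonal projection onto $\mathrm{Inv}(V)$. If moreover $V$ is unitary, then $M$ is also right invariant, and hence is an invariant mean. -/

import Mathlib

open scoped ComplexOrder InnerProductSpace TensorProduct
open UniformSpace

noncomputable section

namespace Eberlein

/-! ### Hilbert space tensor products, slices, von Neumann tensor products -/

section Tensor

variable (K : Type*) [NormedAddCommGroup K] [InnerProductSpace ℂ K]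
variable (H : Type*) [NormedAddCommGroup H] [InnerProductSpace ℂ H]

/-- The Hilbert space tensor product of `K` and `H`: the completion of the algebraic tensor
product with respect to the inner product `⟪k ⊗ h, k' ⊗ h'⟫ = ⟪k, k'⟫ ⟪h, h'⟫`. -/
abbrev HTensor : Type _ := Completion (K ⊗[ℂ] H)

variable {K H}

/-- The continuous linear map `H → K ⊗ H`, `h ↦ k ⊗ h`. -/
def insertLeft (k : K) : H →L[ℂ] HTensor K H :=
  (Completion.toComplL : K ⊗[ℂ] H →L[ℂ] HTensor K H) ∘L TensorProduct.mkL ℂ K H k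

theorem norm_insertLeft_le (k : K) : ‖(insertLeft k : H →L[ℂ] HTensor K H)‖ ≤ ‖k‖ := by
  refine ContinuousLinearMap.opNorm_le_bound _ (norm_nonneg _) fun h => ?_
  simp [insertLeft]

/-- The vector `k ⊗ h` of the Hilbert space tensor product. -/
def tens (k : K) (h : H) : HTensor K H := insertLeft k h

/-- The elementary tensor `x ⊗ y` of two bounded operators, acting on the Hilbert space tensor
product by `(x ⊗ y) (k ⊗ h) = x k ⊗ y h`. -/
def opTensor (x : K →L[ℂ] K) (y : H →L[ℂ] H) : HTensor K H →L[ℂ] HTensor K H :=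
  (TensorProduct.mapL x y).completion

variable [CompleteSpace H]

/-- The slice `(ω_{ξ,η} ⊗ id)(x)`, where `ω_{ξ,η}` is the vector functional `y ↦ ⟪η, y ξ⟫`
(the inner product is linear in the second variable): the operator `T` on `H` with
`⟪h', T h⟫ = ⟪η ⊗ h', x (ξ ⊗ h)⟫`. -/
def vecSlice (ξ η : K) (x : HTensor K H →L[ℂ] HTensor K H) : H →L[ℂ] H :=
  (insertLeft η).adjoint ∘L x ∘L insertLeft ξ

theorem inner_vecSlice (ξ η : K) (x : HTensor K H →L[ℂ] HTensor K H) (h h' : H) :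
    ⟪h', vecSlice ξ η x h⟫_ℂ = ⟪tens η h', x (tens ξ h)⟫_ℂ := by
  simp [vecSlice, tens, ContinuousLinearMap.adjoint_inner_right]

theorem norm_vecSlice_le (ξ η : K) (x : HTensor K H →L[ℂ] HTensor K H) :
    ‖vecSlice ξ η x‖ ≤ ‖η‖ * ‖x‖ * ‖ξ‖ := by
  unfold vecSlice
  grw [ContinuousLinearMap.opNorm_comp_le, ContinuousLinearMap.opNorm_comp_le,
    LinearIsometryEquiv.norm_map, norm_insertLeft_le, norm_insertLeft_le, mul_assoc]

/-- The sesquilinear form `(η, ξ) ↦ ω ((ω_{ξ,η} ⊗ id)(x))` on `K`. -/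
def sliceForm (ω : StrongDual ℂ (H →L[ℂ] H)) (x : HTensor K H →L[ℂ] HTensor K H) :
    K →L⋆[ℂ] K →L[ℂ] ℂ :=
  LinearMap.mkContinuous₂
    (LinearMap.mk₂'ₛₗ (starRingEnd ℂ) (RingHom.id ℂ) (fun η ξ => ω (vecSlice ξ η x))
      (fun η η' ξ => by
        rw [← map_add]; congr 1
        simp [vecSlice, insertLeft])
      (fun c η ξ => by
        rw [← map_smul]; congr 1
        simp [vecSlice, insertLeft, map_smulₛₗ])
      (fun η ξ ξ' => by
        rw [← map_add]; congr 1
        simp [vecSlice, insertLeft])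
      (fun c η ξ => by
        rw [RingHom.id_apply, ← map_smul]; congr 1
        simp [vecSlice, insertLeft]))
    (‖ω‖ * ‖x‖) fun η ξ => by
      simp only [LinearMap.mk₂'ₛₗ_apply]
      grw [ω.le_opNorm, norm_vecSlice_le]
      exact le_of_eq (by ring)

variable [CompleteSpace K]

/-- The slice `(id ⊗ ω)(x)`, the operator `T` on `K` with
`⟪η, T ξ⟫ = ω ((ω_{ξ,η} ⊗ id)(x))` for all `ξ`, `η`. -/
def rightSlice (ω : StrongDual ℂ (H →L[ℂ] H)) (x : HTensor K H →L[ℂ] HTensor K H) :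
    K →L[ℂ] K :=
  (InnerProductSpace.continuousLinearMapOfBilin (sliceForm ω x)).adjoint

theorem inner_rightSlice (ω : StrongDual ℂ (H →L[ℂ] H)) (x : HTensor K H →L[ℂ] HTensor K H)
    (ξ η : K) : ⟪η, rightSlice ω x ξ⟫_ℂ = ω (vecSlice ξ η x) := by
  simp [rightSlice, ContinuousLinearMap.adjoint_inner_right, sliceForm]

variable (H) in
/-- The predual of `B(H)`: the normal functionals `ω = ∑ₙ ω_{ξₙ,ηₙ}` with `∑ₙ ‖ξₙ‖² < ∞` and
`∑ₙ ‖ηₙ‖² < ∞`. -/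
def predual : Set (StrongDual ℂ (H →L[ℂ] H)) :=
  {ω | ∃ ξ η : ℕ → H, Summable (fun n => ‖ξ n‖ ^ 2) ∧ Summable (fun n => ‖η n‖ ^ 2) ∧
    ∀ y : H →L[ℂ] H, HasSum (fun n => ⟪η n, y (ξ n)⟫_ℂ) (ω y)}

/-- The von Neumann algebra generated by a set of operators: the double commutant of its
star-closure. -/
def vonNeumannGen (S : Set (K →L[ℂ] K)) : VonNeumannAlgebra K where
  toStarSubalgebra := StarSubalgebra.centralizer ℂ (StarSubalgebra.centralizer ℂ S : Set (K →L[ℂ] K))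
  centralizer_centralizer' := by
    change ((StarSubalgebra.centralizer ℂ (StarSubalgebra.centralizer ℂ S : Set (K →L[ℂ] K)) :
      Set (K →L[ℂ] K))).centralizer.centralizer = ((StarSubalgebra.centralizer ℂ
        (StarSubalgebra.centralizer ℂ S : Set (K →L[ℂ] K)) : Set (K →L[ℂ] K)))
    rw [StarSubalgebra.coe_centralizer_centralizer, Set.centralizer_centralizer_centralizer]

/-- The von Neumann algebra tensor product: the von Neumann algebra on the Hilbert space tensor
product generated by the elementary tensors `x ⊗ y` with `x ∈ M`, `y ∈ N`. -/
def vonNeumannTensor (M : VonNeumannAlgebra K) (N : VonNeumannAlgebra H) :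
    VonNeumannAlgebra (HTensor K H) :=
  vonNeumannGen {z | ∃ x ∈ M, ∃ y ∈ N, z = opTensor x y}

variable (H) in
/-- `B(H)` as a von Neumann algebra on `H`. -/
def fullAlgebra : VonNeumannAlgebra H := vonNeumannGen Set.univ

theorem mem_fullAlgebra (y : H →L[ℂ] H) : y ∈ fullAlgebra H := by
  change y ∈ ((StarSubalgebra.centralizer ℂ (StarSubalgebra.centralizer ℂ
    (Set.univ : Set (H →L[ℂ] H)) : Set (H →L[ℂ] H)) : Set (H →L[ℂ] H)))
  rw [StarSubalgebra.coe_centralizer_centralizer]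
  exact Set.subset_centralizer_centralizer (by simp)

end Tensor

/-! ### The universal representation of a unital C⋆-algebra and its bidual -/

section Universal

variable (A : Type*) [CStarAlgebra A] [PartialOrder A] [StarOrderedRing A]

/-- The states of `A`, as positive linear functionals. -/
def PState : Type _ := {φ : A →ₚ[ℂ] ℂ // φ 1 = 1}

/-- The Hilbert space of the universal representation: the Hilbert space direct sum of the GNS
spaces of all states. -/
abbrev UnivSpace : Type _ := lp (fun φ : PState A => φ.1.GNS) 2

variable {A}

theorem norm_gns_le (φ : PState A) (a : A) : ‖φ.1.gnsStarAlgHom a‖ ≤ ‖a‖ :=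
  NonUnitalStarAlgHom.norm_apply_le φ.1.gnsStarAlgHom a

variable (A) in
/-- The universal representation of `A`, the direct sum of the GNS representations of all
states. -/
def univRep : A →⋆ₐ[ℂ] (UnivSpace A →L[ℂ] UnivSpace A) where
  toFun a := lp.mapCLM 2 (fun φ : PState A => φ.1.gnsStarAlgHom a) (norm_nonneg a)
    (fun φ => norm_gns_le φ a)
  map_one' := by ext; simp
  map_mul' a b := by ext; simp
  map_zero' := by ext; simp
  map_add' a b := by ext; simp
  commutes' c := by ext; simp [Algebra.algebraMap_eq_smul_one]
  map_star' a := by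
    rw [ContinuousLinearMap.star_eq_adjoint, ContinuousLinearMap.eq_adjoint_iff]
    intro f g
    rw [lp.inner_eq_tsum, lp.inner_eq_tsum]
    refine tsum_congr fun φ => ?_
    simp only [lp.mapCLM_apply_coe, map_star]
    rw [ContinuousLinearMap.star_eq_adjoint, ContinuousLinearMap.adjoint_inner_left]

variable (A) in
/-- The bidual `A**`, realised as usual as the enveloping von Neumann algebra: the double
commutant of `A` in its universal representation. -/
def bidual : VonNeumannAlgebra (UnivSpace A) := vonNeumannGen (Set.range (univRep A))

/-- A state of `A`: a positive functional with value `1` at the unit. -/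
def IsState (μ : StrongDual ℂ A) : Prop := (∀ a : A, 0 ≤ a → 0 ≤ μ a) ∧ μ 1 = 1

open Complex in
/-- The complex-linear extension to `A` of a real functional on the self-adjoint part. -/
def complexify {A : Type*} [CStarAlgebra A] (r : selfAdjoint A →ₗ[ℝ] ℝ) : A →ₗ[ℂ] ℂ where
  toFun a := r (realPart a) + I * r (imaginaryPart a)
  map_add' a b := by simp only [map_add]; push_cast; ring
  map_smul' c a := by
    rw [realPart_smul, imaginaryPart_smul]
    simp only [map_add, map_sub, map_smul, smul_eq_mul, RingHom.id_apply]
    apply Complex.ext <;> simp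

theorem complexify_nonneg {A : Type*} [CStarAlgebra A] [PartialOrder A] [StarOrderedRing A]
    (r : selfAdjoint A →ₗ[ℝ] ℝ) (hr : ∀ x : selfAdjoint A, 0 ≤ (x : A) → 0 ≤ r x) (a : A)
    (ha : 0 ≤ a) : 0 ≤ complexify r a := by
  have h := IsSelfAdjoint.of_nonneg ha
  have h1 : (realPart a : A) = a := h.coe_realPart
  have h2 : imaginaryPart a = 0 := h.imaginaryPart
  simp only [complexify, LinearMap.coe_mk, AddHom.coe_mk, h2, map_zero]
  have := hr (realPart a) (by rwa [h1])
  simpa using this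

/-- Positive functionals are multiples of states. -/
theorem positive_mem_span {A : Type*} [CStarAlgebra A] [PartialOrder A] [StarOrderedRing A]
    (φ : A →ₚ[ℂ] ℂ) : φ.toLinearMap ∈
      Submodule.span ℂ (Set.range fun ψ : PState A => ψ.1.toLinearMap) := by
  by_cases h : φ 1 = 0
  · have : φ.toLinearMap = 0 := by
      ext a
      obtain ⟨x, hx, -, e⟩ := CStarAlgebra.exists_sum_four_nonneg a
      have h0 : ∀ i, φ (x i) = 0 := fun i => by
        have := φ.norm_apply_le_of_nonneg (x i) (hx i)
        rw [h] at this
        simpa using this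
      rw [e]
      simp [h0]
    rw [this]
    exact zero_mem _
  · have h0 : 0 ≤ φ 1 := φ.map_nonneg zero_le_one
    have hinv : 0 ≤ (φ 1)⁻¹ := inv_nonneg.2 h0
    let ψ : PState A := ⟨PositiveLinearMap.mk₀ ((φ 1)⁻¹ • φ.toLinearMap) fun a ha => by
      have := φ.map_nonneg ha
      simpa using mul_nonneg hinv this, by
        change (φ 1)⁻¹ * φ 1 = 1
        exact inv_mul_cancel₀ h⟩
    have : φ.toLinearMap = φ 1 • ψ.1.toLinearMap := by
      ext a
      change φ a = φ 1 * ((φ 1)⁻¹ * φ a)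
      rw [mul_inv_cancel_left₀ h]
    rw [this]
    exact Submodule.smul_mem _ _ (Submodule.subset_span ⟨ψ, rfl⟩)

/-- A bounded real functional on the self-adjoint part is a difference of positive ones. -/
theorem exists_jordan {A : Type*} [CStarAlgebra A] [PartialOrder A] [StarOrderedRing A]
    [Nontrivial A] (r : selfAdjoint A →ₗ[ℝ] ℝ) (C : ℝ) (hC : 0 ≤ C)
    (hr : ∀ x : selfAdjoint A, |r x| ≤ C * ‖(x : A)‖) :
    ∃ r₁ r₂ : selfAdjoint A →ₗ[ℝ] ℝ, (∀ x : selfAdjoint A, 0 ≤ (x : A) → 0 ≤ r₁ x) ∧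
      (∀ x : selfAdjoint A, 0 ≤ (x : A) → 0 ≤ r₂ x) ∧ r = r₁ - r₂ := by
  let X := selfAdjoint A
  let s : PointedCone ℝ (X × X) :=
    { carrier := {p | 0 ≤ (p.1 : A) ∧ 0 ≤ (p.2 : A)}
      add_mem' := fun {a b} ha hb => ⟨by simpa using add_nonneg ha.1 hb.1,
        by simpa using add_nonneg ha.2 hb.2⟩
      zero_mem' := by simp
      smul_mem' := fun c p hp => by
        have hc : (0 : ℝ) ≤ (c : ℝ) := c.2
        exact ⟨smul_nonneg hc hp.1, smul_nonneg hc hp.2⟩ }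
  let j : X × ℝ →ₗ[ℝ] X × X :=
    { toFun := fun p => (p.1 + p.2 • (1 : X), -p.1 + p.2 • (1 : X))
      map_add' := fun p q => by ext <;> simp [add_smul] <;> abel
      map_smul' := fun c p => by ext <;> simp [mul_smul] }
  have hj : Function.Injective j := by
    rw [injective_iff_map_eq_zero]
    rintro ⟨x, t⟩ h
    have h1 : (x : A) + t • (1 : A) = 0 := congrArg (fun p : X × X => (p.1 : A)) h
    have h2 : -(x : A) + t • (1 : A) = 0 := congrArg (fun p : X × X => (p.2 : A)) h
    have h3 : (2 * t) • (1 : A) = 0 := by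
      rw [two_mul, add_smul]
      calc _ = ((x : A) + t • (1 : A)) + (-(x : A) + t • (1 : A)) := by abel
        _ = 0 := by rw [h1, h2, add_zero]
    have h4 : t = 0 := by
      rcases smul_eq_zero.1 h3 with h | h
      · linarith
      · exact absurd h one_ne_zero
    subst h4
    simp only [zero_smul, add_zero] at h1
    ext
    · exact h1
    · rfl
  let e := LinearEquiv.ofInjective j hj
  let g : X × ℝ →ₗ[ℝ] ℝ := r.coprod (LinearMap.toSpanSingleton ℝ ℝ (2 * C * ‖(1 : A)‖))
  let f : (X × X) →ₗ.[ℝ] ℝ := ⟨LinearMap.range j, g ∘ₗ e.symm.toLinearMap⟩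
  have hf : ∀ p : X × ℝ, ∀ q : f.domain, (q : X × X) = j p → f q = g p := by
    intro p q hq
    have : q = e p := Subtype.ext hq
    rw [this]
    change g (e.symm (e p)) = g p
    simp
  obtain ⟨G, hG, hpos⟩ := riesz_extension s f (by
    rintro ⟨_, ⟨x, t⟩, rfl⟩ ⟨h1, h2⟩
    rw [hf (x, t) _ rfl]
    change 0 ≤ (x : A) + t • (1 : A) at h1
    change 0 ≤ -(x : A) + t • (1 : A) at h2
    have h3 : (x : A) + t • (1 : A) ≤ (2 * t) • (1 : A) := by
      rw [← sub_nonneg]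
      convert h2 using 1
      rw [two_mul, add_smul]; abel
    have ht : 0 ≤ t := by
      by_contra ht
      push Not at ht
      have h4 : (0 : A) ≤ (-(2 * t)) • (1 : A) := smul_nonneg (by linarith) zero_le_one
      have h5 : (0 : A) ≤ (2 * t) • (1 : A) := h1.trans h3
      have h6 : (2 * t) • (1 : A) = 0 := by
        apply le_antisymm _ h5
        rw [neg_smul] at h4
        exact neg_nonneg.1 h4
      rcases smul_eq_zero.1 h6 with h | h
      · linarith
      · exact absurd h one_ne_zero
    have h7 : -(x : A) + t • (1 : A) ≤ (2 * t) • (1 : A) := by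
      rw [← sub_nonneg]
      convert h1 using 1
      rw [two_mul, add_smul]; abel
    have n1 := CStarAlgebra.norm_le_norm_of_nonneg_of_le h1 h3
    have n2 := CStarAlgebra.norm_le_norm_of_nonneg_of_le h2 h7
    rw [norm_smul, Real.norm_of_nonneg (by linarith)] at n1 n2
    have n3 : ‖(2 : ℝ) • (x : A)‖ ≤ 2 * t * ‖(1 : A)‖ + 2 * t * ‖(1 : A)‖ := by
      have : (2 : ℝ) • (x : A) = ((x : A) + t • (1 : A)) - (-(x : A) + t • (1 : A)) := by
        rw [two_smul]; abel
      rw [this]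
      exact (norm_sub_le _ _).trans (add_le_add n1 n2)
    rw [norm_smul, Real.norm_of_nonneg (by norm_num)] at n3
    have n4 : C * ‖(x : A)‖ ≤ C * (2 * t * ‖(1 : A)‖) :=
      mul_le_mul_of_nonneg_left (by linarith) hC
    have n5 := (abs_le.1 (hr x)).1
    change 0 ≤ r x + t * (2 * C * ‖(1 : A)‖)
    linarith) (by
    rintro ⟨u, v⟩
    refine ⟨⟨j (0, max ‖(u : A)‖ ‖(v : A)‖), ⟨_, rfl⟩⟩, ?_, ?_⟩
    · change 0 ≤ ((0 : A) + (max ‖(u : A)‖ ‖(v : A)‖) • (1 : A)) + (u : A)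
      have h1 := IsSelfAdjoint.neg_algebraMap_norm_le_self u.2
      have h2 : ‖(u : A)‖ • (1 : A) ≤ (max ‖(u : A)‖ ‖(v : A)‖) • (1 : A) :=
        smul_le_smul_of_nonneg_right (le_max_left _ _) zero_le_one
      rw [Algebra.algebraMap_eq_smul_one] at h1
      rw [zero_add]
      exact neg_le_iff_add_nonneg'.1 ((neg_le_neg h2).trans h1)
    · change 0 ≤ (-(0 : A) + (max ‖(u : A)‖ ‖(v : A)‖) • (1 : A)) + (v : A)
      have h1 := IsSelfAdjoint.neg_algebraMap_norm_le_self v.2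
      have h2 : ‖(v : A)‖ • (1 : A) ≤ (max ‖(u : A)‖ ‖(v : A)‖) • (1 : A) :=
        smul_le_smul_of_nonneg_right (le_max_right _ _) zero_le_one
      rw [Algebra.algebraMap_eq_smul_one] at h1
      rw [neg_zero, zero_add]
      exact neg_le_iff_add_nonneg'.1 ((neg_le_neg h2).trans h1))
  refine ⟨G ∘ₗ LinearMap.inl ℝ X X, G ∘ₗ LinearMap.inr ℝ X X, ?_, ?_, ?_⟩
  · intro x hx
    exact hpos (x, 0) ⟨hx, le_rfl⟩
  · intro x hx
    exact hpos (0, x) ⟨le_rfl, hx⟩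
  · ext x
    have h1 := hG ⟨j (x, 0), ⟨_, rfl⟩⟩
    rw [hf (x, 0) _ rfl] at h1
    have h2 : j (x, 0) = (x, 0) - (0, x) := by ext <;> simp [j]
    simp only [h2, map_sub] at h1
    have h3 : g (x, 0) = r x := by simp [g]
    rw [h3] at h1
    exact h1.symm

/-- Bounded functionals are finite linear combinations of states. -/
theorem mem_span_states {A : Type*} [CStarAlgebra A] [PartialOrder A] [StarOrderedRing A]
    (μ : StrongDual ℂ A) : μ.toLinearMap ∈
      Submodule.span ℂ (Set.range fun ψ : PState A => ψ.1.toLinearMap) := by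
  cases subsingleton_or_nontrivial A
  · have : μ.toLinearMap = 0 := by
      ext a
      simp [Subsingleton.elim a 0]
    rw [this]
    exact zero_mem _
  have key : ∀ r : selfAdjoint A →ₗ[ℝ] ℝ, (∀ x : selfAdjoint A, |r x| ≤ ‖μ‖ * ‖(x : A)‖) →
      complexify r ∈ Submodule.span ℂ (Set.range fun ψ : PState A => ψ.1.toLinearMap) := by
    intro r hr
    obtain ⟨r₁, r₂, h1, h2, rfl⟩ := exists_jordan r ‖μ‖ (norm_nonneg _) hr
    have : complexify (r₁ - r₂) = complexify r₁ - complexify r₂ := by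
      ext a
      simp only [complexify, LinearMap.coe_mk, AddHom.coe_mk, LinearMap.sub_apply]
      push_cast; ring
    rw [this]
    exact sub_mem
      (positive_mem_span (PositiveLinearMap.mk₀ (complexify r₁) (complexify_nonneg r₁ h1)))
      (positive_mem_span (PositiveLinearMap.mk₀ (complexify r₂) (complexify_nonneg r₂ h2)))
  let i : selfAdjoint A →ₗ[ℝ] A := (selfAdjoint.submodule ℝ A).subtype
  let m : selfAdjoint A →ₗ[ℝ] ℂ := (μ.toLinearMap.restrictScalars ℝ) ∘ₗ i
  have hm : ∀ x, m x = μ x := fun _ => rfl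
  have e : μ.toLinearMap = complexify (Complex.reLm ∘ₗ m) +
      Complex.I • complexify (Complex.imLm ∘ₗ m) := by
    ext a
    have h := realPart_add_I_smul_imaginaryPart a
    have h' : μ a = m (realPart a) + Complex.I * m (imaginaryPart a) := by
      rw [hm, hm]
      conv_lhs => rw [← h]
      simp
    change μ a = _
    rw [h']
    apply Complex.ext <;> simp [complexify] <;> ring
  rw [e]
  refine add_mem (key _ fun x => ?_) (Submodule.smul_mem _ _ (key _ fun x => ?_))
  · exact (Complex.abs_re_le_norm _).trans (μ.le_opNorm _)
  · exact (Complex.abs_im_le_norm _).trans (μ.le_opNorm _)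

/-- The canonical cyclic vector of the GNS representation of a state. -/
def cyclic {A : Type*} [CStarAlgebra A] [PartialOrder A] [StarOrderedRing A] (φ : PState A) :
    φ.1.GNS := ((φ.1.toPreGNS 1 : φ.1.PreGNS) : Completion φ.1.PreGNS)

theorem inner_cyclic {A : Type*} [CStarAlgebra A] [PartialOrder A] [StarOrderedRing A]
    (φ : PState A) (a : A) : ⟪cyclic φ, φ.1.gnsStarAlgHom a (cyclic φ)⟫_ℂ = φ.1 a := by
  simp [cyclic, PositiveLinearMap.preGNS_inner_def]

/-- Every bounded functional on `A` is a vector functional in the universal representation. -/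
theorem exists_vectors {A : Type*} [CStarAlgebra A] [PartialOrder A] [StarOrderedRing A]
    (μ : StrongDual ℂ A) :
    ∃ v : UnivSpace A × UnivSpace A, ∀ a : A, μ a = ⟪v.2, univRep A a v.1⟫_ℂ := by
  classical
  obtain ⟨c, hc⟩ := (Finsupp.mem_span_range_iff_exists_finsupp).1 (mem_span_states μ)
  refine ⟨(∑ φ ∈ c.support, lp.single 2 φ (c φ • cyclic φ),
    ∑ φ ∈ c.support, lp.single 2 φ (cyclic φ)), fun a => ?_⟩
  have h : μ a = ∑ φ ∈ c.support, c φ * φ.1 a := by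
    have := congrArg (fun l : A →ₗ[ℂ] ℂ => l a) hc
    simpa [Finsupp.sum] using this.symm
  rw [h, sum_inner]
  refine Finset.sum_congr rfl fun φ hφ => ?_
  have h1 : univRep A a (∑ φ ∈ c.support, lp.single 2 φ (c φ • cyclic φ)) φ =
      φ.1.gnsStarAlgHom a ((∑ φ ∈ c.support, lp.single 2 φ (c φ • cyclic φ) : UnivSpace A) φ) :=
    rfl
  have h2 : (∑ φ ∈ c.support, lp.single 2 φ (c φ • cyclic φ) : UnivSpace A) φ =
      c φ • cyclic φ := by
    rw [lp.coeFn_sum, Finset.sum_apply, Finset.sum_eq_single φ]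
    · simp
    · intro ψ _ hne
      simp [lp.single_apply, hne.symm]
    · intro h; exact absurd hφ h
  rw [lp.inner_single_left, h1, h2, map_smul, inner_smul_right, inner_cyclic]

/-- A pair `(ξ, η)` of vectors of the universal representation with `μ a = ⟪η, a ξ⟫` for all
`a ∈ A`. The normal extension of `μ` to `A**` is the restriction of `ω_{ξ,η}`; as `A` is weak-star dense
in `A**`, it does not depend on the chosen pair, and neither do the slices and pairings below of
elements of the von Neumann tensor products. -/
def vecs (μ : StrongDual ℂ A) : UnivSpace A × UnivSpace A := Classical.choose (exists_vectors μ)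

theorem inner_vecs (μ : StrongDual ℂ A) (a : A) :
    ⟪(vecs μ).2, univRep A a (vecs μ).1⟫_ℂ = μ a :=
  (Classical.choose_spec (exists_vectors μ) a).symm

/-- The slice `(μ ⊗ id)(x)` for `μ ∈ A*` and `x ∈ A** ⊗ B(H)`. -/
def leftSlice {H : Type*} [NormedAddCommGroup H] [InnerProductSpace ℂ H] [CompleteSpace H]
    (μ : StrongDual ℂ A) (x : HTensor (UnivSpace A) H →L[ℂ] HTensor (UnivSpace A) H) :
    H →L[ℂ] H :=
  vecSlice (vecs μ).1 (vecs μ).2 x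

/-- The product `μ ⋆ ν ∈ A*` induced by a coproduct `Φ` with values in the von Neumann tensor
product `A** ⊗ A**`, given by `(μ ⋆ ν)(a) = ⟨Φ a, μ ⊗ ν⟩`. -/
def conv (Φ : A →⋆ₐ[ℂ] (HTensor (UnivSpace A) (UnivSpace A) →L[ℂ]
      HTensor (UnivSpace A) (UnivSpace A))) (μ ν : StrongDual ℂ A) : StrongDual ℂ A :=
  LinearMap.mkContinuous
    { toFun := fun a => ⟪tens (vecs μ).2 (vecs ν).2, Φ a (tens (vecs μ).1 (vecs ν).1)⟫_ℂ
      map_add' := fun a b => by simp [inner_add_right]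
      map_smul' := fun c a => by simp [inner_smul_right] }
    (‖tens (vecs μ).2 (vecs ν).2‖ * ‖tens (vecs μ).1 (vecs ν).1‖) fun a => by
      simp only [LinearMap.coe_mk, AddHom.coe_mk]
      have hΦ : ‖Φ a‖ ≤ ‖a‖ := NonUnitalStarAlgHom.norm_apply_le Φ a
      grw [norm_inner_le_norm, ContinuousLinearMap.le_opNorm, hΦ]
      exact le_of_eq (by ring)

end Universal

/-! ### C⋆-Eberlein algebras -/

section EberleinAlgebra

/-- A (unital) C⋆-Eberlein algebra `(A, Φ, V, H)` with given C⋆-algebra `A` and Hilbert space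
`H`. -/
structure CStarEberlein (A : Type*) [CStarAlgebra A] [PartialOrder A] [StarOrderedRing A]
    (H : Type*) [NormedAddCommGroup H] [InnerProductSpace ℂ H] [CompleteSpace H] where
  /-- The coproduct, a unital star-homomorphism `A → A** ⊗ A**` (von Neumann tensor product). -/
  Φ : A →⋆ₐ[ℂ] (HTensor (UnivSpace A) (UnivSpace A) →L[ℂ] HTensor (UnivSpace A) (UnivSpace A))
  Φ_mem : ∀ a, Φ a ∈ vonNeumannTensor (bidual A) (bidual A)
  /-- The generating corepresentation, a contraction in `A** ⊗ B(H)`. -/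
  V : HTensor (UnivSpace A) H →L[ℂ] HTensor (UnivSpace A) H
  V_mem : V ∈ vonNeumannTensor (bidual A) (fullAlgebra H)
  norm_V_le : ‖V‖ ≤ 1
  /-- `A_V = {(id ⊗ ω)(V)}` is contained in `A ⊆ A**`. -/
  coeff_mem : ∀ ω ∈ predual H, rightSlice ω V ∈ Set.range (univRep A)
  /-- `A_V` is norm dense in `A`. -/
  coeff_dense : Dense {a : A | ∃ ω ∈ predual H, univRep A a = rightSlice ω V}
  /-- The product of `A*` induced by `Φ` is associative. -/
  conv_assoc : ∀ μ ν τ : StrongDual ℂ A, conv Φ (conv Φ μ ν) τ = conv Φ μ (conv Φ ν τ)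
  /-- `μ ↦ (μ ⊗ id)(V)` is a homomorphism (its linearity is automatic). -/
  leftSlice_conv : ∀ μ ν : StrongDual ℂ A,
    leftSlice (conv Φ μ ν) V = leftSlice μ V ∘L leftSlice ν V

namespace CStarEberlein

variable {A : Type*} [CStarAlgebra A] [PartialOrder A] [StarOrderedRing A]
  {H : Type*} [NormedAddCommGroup H] [InnerProductSpace ℂ H] [CompleteSpace H]
  (S : CStarEberlein A H)

/-- The closed subspace `Inv(V)` of the vectors `ξ` with `(μ ⊗ id)(V) ξ = μ(1) ξ` for every
`μ ∈ A*`. -/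
def inv : Submodule ℂ H :=
  ⨅ μ : StrongDual ℂ A, LinearMap.eqLocus (leftSlice μ S.V).toLinearMap
    (μ 1 • ContinuousLinearMap.id ℂ H).toLinearMap

theorem mem_inv {ξ : H} : ξ ∈ S.inv ↔ ∀ μ : StrongDual ℂ A, leftSlice μ S.V ξ = μ 1 • ξ := by
  simp [inv]

theorem isClosed_inv : IsClosed (S.inv : Set H) := by
  have : (S.inv : Set H) = ⋂ μ : StrongDual ℂ A, {ξ | leftSlice μ S.V ξ = μ 1 • ξ} := by
    ext ξ
    simp [mem_inv]
  rw [this]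
  exact isClosed_iInter fun μ => isClosed_eq (by fun_prop) (by fun_prop)

instance : CompleteSpace S.inv := S.isClosed_inv.completeSpace_coe

/-- A left invariant mean: a state `M` with `⟨M, a · μ⟩ = ⟨M, a⟩` for all states `μ` and all
`a ∈ A`, where `a · μ` is given by `⟨a · μ, ν⟩ = ⟨μ ⋆ ν, a⟩` for `ν ∈ A*`, so that
`⟨M, a · μ⟩ = (μ ⋆ M)(a)`. -/
def IsLeftInvariantMean (M : StrongDual ℂ A) : Prop :=
  IsState M ∧ ∀ μ : StrongDual ℂ A, IsState μ → ∀ a : A, conv S.Φ μ M a = M a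

/-- A right invariant mean: a state `M` with `⟨M, μ · a⟩ = ⟨M, a⟩` for all states `μ` and all
`a ∈ A`, where `μ · a` is given by `⟨μ · a, ν⟩ = ⟨ν ⋆ μ, a⟩` for `ν ∈ A*`, so that
`⟨M, μ · a⟩ = (M ⋆ μ)(a)`. -/
def IsRightInvariantMean (M : StrongDual ℂ A) : Prop :=
  IsState M ∧ ∀ μ : StrongDual ℂ A, IsState μ → ∀ a : A, conv S.Φ M μ a = M a

/-- An invariant mean: a mean that is both left and right invariant. -/
def IsInvariantMean (M : StrongDual ℂ A) : Prop :=
  S.IsLeftInvariantMean M ∧ S.IsRightInvariantMean M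

end CStarEberlein

end EberleinAlgebra

end Eberlein

end

/-!
For `μ ∈ A*` write `π μ = (μ ⊗ id)(V)`. Since the slices `(id ⊗ ω)(V)` belong to `A`, every normal
functional `ω` of `B(H)` has a coefficient `a ∈ A` with `ω (π μ) = μ a` for all `μ`
(`CStarEberlein.exists_coeff`). This has three consequences.

* `π μ` may be computed with any pair of vectors implementing `μ`
  (`CStarEberlein.leftSlice_eq_vecSlice`); a state is implemented by a unit vector of its GNS
  space, so `π μ` is a contraction if `μ` is a state.
* `π` is linear, in the form that a vector fixed by `π μ` for all states `μ` is invariant for `V`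
  (`CStarEberlein.mem_inv_of_isState`).
* `π` is injective, because the coefficients are dense (`CStarEberlein.leftSlice_injective`).

If `M` is a left invariant mean, then `π μ ∘ π M = π (μ ⋆ M) = π M` for all states `μ`, so the range
of `π M` lies in `Inv(V)`, on which `π M` is the identity. A vector fixed by a contraction is also
fixed by its adjoint; hence `(π M)† ξ = ξ` for `ξ ∈ Inv(V)`, which says that `h - π M h` is
orthogonal to `Inv(V)` for every `h`. So `π M` is the orthogonal projection onto `Inv(V)`, and `M`
is determined by it. In the same way `(π μ)† ξ = ξ` for all states `μ` and `ξ ∈ Inv(V)`, so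
`π (M ⋆ μ) = π M ∘ π μ = ((π μ)† ∘ π M)† = π M` and `M ⋆ μ = M`.
-/

open scoped ComplexOrder InnerProductSpace TensorProduct
open UniformSpace

namespace Eberlein

/-! ### Contractions and vector functionals -/

section Hilbert

variable {H : Type*} [NormedAddCommGroup H] [InnerProductSpace ℂ H]

theorem adjoint_apply_eq_self_of_norm_le_one [CompleteSpace H] {T : H →L[ℂ] H} (hT : ‖T‖ ≤ 1) {x : H}
    (hx : T x = x) : T.adjoint x = x := by
  have h1 : ‖T.adjoint x‖ ≤ ‖x‖ := by
    grw [ContinuousLinearMap.le_opNorm, LinearIsometryEquiv.norm_map, hT, one_mul]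
  have h2 : ⟪T.adjoint x, x⟫_ℂ = ⟪x, x⟫_ℂ := by
    rw [ContinuousLinearMap.adjoint_inner_left, hx]
  have h3 : ‖T.adjoint x - x‖ ^ 2 ≤ 0 := by
    have h4 : RCLike.re ⟪x, x⟫_ℂ = ‖x‖ ^ 2 := inner_self_eq_norm_sq x
    rw [@norm_sub_sq ℂ, h2, h4]
    nlinarith [norm_nonneg (T.adjoint x), norm_nonneg x]
  exact sub_eq_zero.1 (norm_eq_zero.1 (pow_eq_zero_iff two_ne_zero |>.1
    (le_antisymm h3 (sq_nonneg _))))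

/-- The vector functional `ω_{ξ,η} : y ↦ ⟪η, y ξ⟫` on `B(H)`. -/
noncomputable def vectorFunctional (ξ η : H) : StrongDual ℂ (H →L[ℂ] H) :=
  innerSL ℂ η ∘L ContinuousLinearMap.apply ℂ H ξ

theorem vectorFunctional_apply (ξ η : H) (y : H →L[ℂ] H) :
    vectorFunctional ξ η y = ⟪η, y ξ⟫_ℂ := rfl

theorem vectorFunctional_mem_predual (ξ η : H) : vectorFunctional ξ η ∈ predual H := by
  refine ⟨Pi.single 0 ξ, Pi.single 0 η, ?_, ?_, fun y => ?_⟩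
  · exact summable_of_ne_finset_zero (s := {0}) fun n hn => by
      simp [Pi.single_eq_of_ne (by simpa using hn : n ≠ 0)]
  · exact summable_of_ne_finset_zero (s := {0}) fun n hn => by
      simp [Pi.single_eq_of_ne (by simpa using hn : n ≠ 0)]
  · convert hasSum_single (f := fun n => ⟪(Pi.single 0 η : ℕ → H) n,
      y ((Pi.single 0 ξ : ℕ → H) n)⟫_ℂ) 0 fun n hn => by simp [Pi.single_eq_of_ne hn] using 1
    simp [vectorFunctional_apply]

end Hilbert

/-! ### States as vector states of the universal representation -/

section States

variable {A : Type*} [CStarAlgebra A] [PartialOrder A] [StarOrderedRing A]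

/-- A state of `A`, bundled as a positive linear functional. -/
noncomputable def IsState.toPState {μ : StrongDual ℂ A} (hμ : IsState μ) : PState A :=
  ⟨PositiveLinearMap.mk₀ μ.toLinearMap hμ.1, hμ.2⟩

/-- The functional is implemented by the cyclic vector of its own GNS space, viewed in the
universal representation. -/
theorem IsState.exists_unit_vector {μ : StrongDual ℂ A} (hμ : IsState μ) :
    ∃ v : UnivSpace A, ‖v‖ = 1 ∧ ∀ a : A, μ a = ⟪v, univRep A a v⟫_ℂ := by
  classical
  have key (a : A) : μ a = ⟪(lp.single 2 hμ.toPState (cyclic hμ.toPState) : UnivSpace A),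
      univRep A a (lp.single 2 hμ.toPState (cyclic hμ.toPState))⟫_ℂ := by
    have h1 : univRep A a (lp.single 2 hμ.toPState (cyclic hμ.toPState)) hμ.toPState =
        hμ.toPState.1.gnsStarAlgHom a
          ((lp.single 2 hμ.toPState (cyclic hμ.toPState) : UnivSpace A) hμ.toPState) := rfl
    rw [lp.inner_single_left, h1, lp.single_apply_self, inner_cyclic]
    rfl
  refine ⟨_, ?_, key⟩
  have h := key 1
  rw [hμ.2, map_one, one_apply_eq_self] at h
  have h' : ‖(lp.single 2 hμ.toPState (cyclic hμ.toPState) : UnivSpace A)‖ ^ 2 = 1 := by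
    rw [← inner_self_eq_norm_sq (𝕜 := ℂ), ← h, RCLike.one_re]
  exact (pow_eq_one_iff_of_nonneg (norm_nonneg _) two_ne_zero).1 h'

theorem PState.exists_isState (φ : PState A) :
    ∃ μ : StrongDual ℂ A, IsState μ ∧ ∀ a, μ a = φ.1 a := by
  refine ⟨LinearMap.mkContinuous φ.1.toLinearMap (‖cyclic φ‖ * ‖cyclic φ‖) fun a => ?_,
    ⟨fun a ha => φ.1.map_nonneg ha, φ.2⟩, fun a => rfl⟩
  change ‖φ.1 a‖ ≤ _
  rw [← inner_cyclic]
  grw [norm_inner_le_norm, ContinuousLinearMap.le_opNorm, norm_gns_le]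
  exact le_of_eq (by ring)

/-- A functional on `A` vanishes at any element at which all states vanish. -/
theorem apply_eq_zero_of_isState {x : A} (hx : ∀ μ : StrongDual ℂ A, IsState μ → μ x = 0)
    (μ : StrongDual ℂ A) : μ x = 0 := by
  have h : Submodule.span ℂ (Set.range fun ψ : PState A => ψ.1.toLinearMap) ≤
      LinearMap.ker (LinearMap.applyₗ x : (A →ₗ[ℂ] ℂ) →ₗ[ℂ] ℂ) := by
    rw [Submodule.span_le]
    rintro _ ⟨φ, rfl⟩
    obtain ⟨ν, hν, e⟩ := φ.exists_isState
    exact (e x).symm.trans (hx ν hν)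
  exact h (mem_span_states μ)

end States

/-! ### Slices of the generating corepresentation -/

namespace CStarEberlein

variable {A : Type*} [CStarAlgebra A] [PartialOrder A] [StarOrderedRing A]
  {H : Type*} [NormedAddCommGroup H] [InnerProductSpace ℂ H] [CompleteSpace H]
  (S : CStarEberlein A H)

/-- The matrix coefficient of `V` at `h, h'` is an element of `A`, so it may be evaluated with any
pair of vectors implementing a given functional. -/
theorem exists_coeff (h h' : H) : ∃ a : A, ∀ (μ : StrongDual ℂ A) (ξ η : UnivSpace A),
    (∀ b, μ b = ⟪η, univRep A b ξ⟫_ℂ) → ⟪h', vecSlice ξ η S.V h⟫_ℂ = μ a := by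
  obtain ⟨a, ha⟩ := S.coeff_mem _ (vectorFunctional_mem_predual h h')
  refine ⟨a, fun μ ξ η hμ => ?_⟩
  rw [hμ, ha, inner_rightSlice, vectorFunctional_apply]

theorem leftSlice_eq_vecSlice (μ : StrongDual ℂ A) (ξ η : UnivSpace A)
    (hμ : ∀ b, μ b = ⟪η, univRep A b ξ⟫_ℂ) : leftSlice μ S.V = vecSlice ξ η S.V := by
  ext h
  refine ext_inner_left ℂ fun h' => ?_
  obtain ⟨a, ha⟩ := S.exists_coeff h h'
  rw [ha μ ξ η hμ]
  exact ha μ _ _ fun b => (inner_vecs μ b).symm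

theorem norm_leftSlice_le_one {μ : StrongDual ℂ A} (hμ : IsState μ) : ‖leftSlice μ S.V‖ ≤ 1 := by
  obtain ⟨v, hv, e⟩ := hμ.exists_unit_vector
  rw [S.leftSlice_eq_vecSlice μ v v e]
  grw [norm_vecSlice_le, hv, S.norm_V_le]
  norm_num

/-- It suffices to test invariance on states, since `μ ↦ (μ ⊗ id)(V)` is linear and the states
span `A*`. -/
theorem mem_inv_of_isState {ξ : H}
    (hξ : ∀ μ : StrongDual ℂ A, IsState μ → leftSlice μ S.V ξ = ξ) : ξ ∈ S.inv := by
  rw [mem_inv]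
  intro μ
  refine ext_inner_left ℂ fun h' => ?_
  obtain ⟨a, ha⟩ := S.exists_coeff ξ h'
  have ha' (ν : StrongDual ℂ A) : ⟪h', leftSlice ν S.V ξ⟫_ℂ = ν a :=
    ha ν _ _ fun b => (inner_vecs ν b).symm
  have h := apply_eq_zero_of_isState (x := a - ⟪h', ξ⟫_ℂ • (1 : A)) (fun ν hν => by
    rw [map_sub, map_smul, hν.2, ← ha', hξ ν hν, smul_eq_mul, mul_one, sub_self]) μ
  rw [map_sub, map_smul, sub_eq_zero] at h
  rw [ha', h, inner_smul_right, smul_eq_mul, mul_comm]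

theorem leftSlice_injective : Function.Injective fun μ : StrongDual ℂ A => leftSlice μ S.V := by
  intro μ ν h
  refine DFunLike.coe_injective (Continuous.ext_on S.coeff_dense μ.continuous ν.continuous ?_)
  rintro a ⟨ω, -, ha⟩
  have e (τ : StrongDual ℂ A) : τ a = ω (leftSlice τ S.V) := by
    rw [← inner_vecs τ a, ha, inner_rightSlice, leftSlice]
  rw [e, e]
  exact congrArg ω h

theorem adjoint_leftSlice_apply_of_mem_inv {μ : StrongDual ℂ A} (hμ : IsState μ) {ξ : H}
    (hξ : ξ ∈ S.inv) : (leftSlice μ S.V).adjoint ξ = ξ :=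
  adjoint_apply_eq_self_of_norm_le_one (S.norm_leftSlice_le_one hμ) <| by
    rw [S.mem_inv.1 hξ μ, hμ.2, one_smul]

/-! ### Invariant means -/

variable {S} {M : StrongDual ℂ A}

theorem IsLeftInvariantMean.leftSlice_eq_starProjection (hM : S.IsLeftInvariantMean M) :
    leftSlice M S.V = S.inv.starProjection := by
  ext h
  refine (Submodule.eq_starProjection_of_mem_of_inner_eq_zero ?_ fun x hx => ?_).symm
  · refine S.mem_inv_of_isState fun μ hμ => ?_
    have e : conv S.Φ μ M = M := ContinuousLinearMap.ext (hM.2 μ hμ)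
    rw [← ContinuousLinearMap.comp_apply, ← S.leftSlice_conv, e]
  · rw [inner_sub_left, ← ContinuousLinearMap.adjoint_inner_right,
      S.adjoint_leftSlice_apply_of_mem_inv hM.1 hx, sub_self]

theorem IsLeftInvariantMean.isRightInvariantMean (hM : S.IsLeftInvariantMean M) :
    S.IsRightInvariantMean M := by
  refine ⟨hM.1, fun μ hμ => DFunLike.congr_fun (S.leftSlice_injective ?_)⟩
  change leftSlice (conv S.Φ M μ) S.V = leftSlice M S.V
  rw [S.leftSlice_conv, hM.leftSlice_eq_starProjection]
  ext h
  refine ext_inner_left ℂ fun h' => ?_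
  rw [ContinuousLinearMap.comp_apply, ← Submodule.inner_starProjection_left_eq_right,
    ← ContinuousLinearMap.adjoint_inner_left,
    S.adjoint_leftSlice_apply_of_mem_inv hμ (Submodule.starProjection_apply_mem _ _),
    Submodule.inner_starProjection_left_eq_right]

end CStarEberlein

end Eberlein

theorem mainTheorem2 {A : Type*} [CStarAlgebra A] [PartialOrder A] [StarOrderedRing A]
    {H : Type*} [NormedAddCommGroup H] [InnerProductSpace ℂ H] [CompleteSpace H]
    (S : Eberlein.CStarEberlein A H) (M : StrongDual ℂ A) (hM : S.IsLeftInvariantMean M) :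
    (∀ N : StrongDual ℂ A, S.IsLeftInvariantMean N → N = M) ∧
    Eberlein.leftSlice M S.V = S.inv.starProjection ∧
    (S.V ∈ unitary (Eberlein.HTensor (Eberlein.UnivSpace A) H →L[ℂ]
        Eberlein.HTensor (Eberlein.UnivSpace A) H) →
      S.IsRightInvariantMean M ∧ S.IsInvariantMean M) :=
  ⟨fun _ hN => S.leftSlice_injective
      (hN.leftSlice_eq_starProjection.trans hM.leftSlice_eq_starProjection.symm),
    hM.leftSlice_eq_starProjection,
    fun _ => ⟨hM.isRightInvariantMean, hM, hM.isRightInvariantMean⟩⟩
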